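/- Let $p$ be an odd prime, let $m,s\ge 1$ be integers, let $F=\mathbb{F}_{p^m}$ and $\mathcal R=F[u,v]/\langle u^2,v^2,uv-vu\rangle$. Let $\alpha=\alpha_1+\alpha_2u+\alpha_3v+\alpha_4uv\in\mathcal R$ with $\alpha_1,\alpha_2,\alpha_3\in F\setminus\{0\}$ and $\alpha_4\in F$, and suppose that $\alpha$ is not a square in $\mathcal R$. Put $\alpha_0=\alpha_1^{p^{m-r_0}}$, where $r_0$ is the remainder of $s$ modulo $m$; thus $\alpha_0^{p^s}=\alpha_1$. Let $\mathcal R_\alpha=\mathcal R[x]/\langle x^{2p^s}-\alpha\rangle$. An ideal of $\mathcal R_\alpha$ is regarded as a code of length $2p^s$ over $\mathcal R$ by identifying $c_0+c_1x+\dots+c_{2p^s-1}x^{2p^s-1}$ with the word $(c_0,\dots,c_{2p^s-1})$, and $d_H$ of a code is the minimum of the Hamming distances between two distinct codewords. Let $0\le\ell\le 2p^s-1$ and $0\le t<\ell$, and let $z(x)\in\mathcal R_\alpha$ be $0$ or a unit. Let $\Im$ be the smallest integer $j\ge 0$ such that $u(x^2-\alpha_0)^{j}\in\langle (x^2-\alpha_0)^\ell+u(x^2-\alpha_0)^tz(x)\rangle$,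 let $0\le\mu\le\Im$, and let $$\mathcal C=\langle (x^2-\alpha_0)^\ell+u(x^2-\alpha_0)^tz(x),\ u(x^2-\alpha_0)^\mu\rangle\subseteq\mathcal R_\alpha .$$ Then $d_H(\mathcal C)=d_H(\langle u(x^2-\alpha_0)^\mu\rangle)$, and - $d_H(\mathcal C)=1$ if $0\le\mu\le p^s$; - $d_H(\mathcal C)=(\Gamma+1)p^\gamma$ if $2p^s-p^{s-\gamma}+(\Gamma-1)p^{s-\gamma-1}+1\le\mu\le 2p^s-p^{s-\gamma}+\Gamma p^{s-\gamma-1}$, where $1\le\Gamma\le p-1$ and $0\le\gamma\le s-1$. -/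

import Mathlib

open Polynomial

noncomputable section

namespace ConstacyclicUV

/-- The ring `𝓡 = F[u, v] / ⟨u², v², uv - vu⟩`. -/
abbrev BaseRing (F : Type*) [Field F] : Type _ :=
  MvPolynomial (Fin 2) F ⧸ (Ideal.span
    {MvPolynomial.X 0 ^ 2, MvPolynomial.X 1 ^ 2,
      MvPolynomial.X 0 * MvPolynomial.X 1 - MvPolynomial.X 1 * MvPolynomial.X 0} :
    Ideal (MvPolynomial (Fin 2) F))

/-- The element `u` of `𝓡`. -/
def uElt (F : Type*) [Field F] : BaseRing F := Ideal.Quotient.mk _ (MvPolynomial.X 0)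

/-- The element `v` of `𝓡`. -/
def vElt (F : Type*) [Field F] : BaseRing F := Ideal.Quotient.mk _ (MvPolynomial.X 1)

/-- The element `a + b u + c v + d uv` of `𝓡`. -/
def elt {F : Type*} [Field F] (a b c d : F) : BaseRing F :=
  algebraMap F (BaseRing F) a + algebraMap F (BaseRing F) b * uElt F
    + algebraMap F (BaseRing F) c * vElt F + algebraMap F (BaseRing F) d * (uElt F * vElt F)

/-- The ambient ring `A[x] / ⟨xⁿ - α⟩` of the `α`-constacyclic codes of length `n` over `A`. -/
abbrev Ambient {A : Type*} [CommRing A] (n : ℕ) (α : A) : Type _ :=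
  AdjoinRoot (X ^ n - C α : A[X])

/-- The code of length `n` over `A` given by an ideal `I` of `A[x] / ⟨xⁿ - α⟩`: the words
`(c₀, …, cₙ₋₁)` whose polynomial representation `c₀ + c₁ x + ⋯ + cₙ₋₁ xⁿ⁻¹` lies in `I`. -/
def codeOfIdeal {A : Type*} [CommRing A] {n : ℕ} {α : A} (I : Ideal (Ambient n α)) :
    Set (Fin n → A) :=
  {c | AdjoinRoot.mk (X ^ n - C α : A[X]) (∑ i : Fin n, C (c i) * X ^ (i : ℕ)) ∈ I}

open Classical in
/-- The Hamming distance of a code: the minimum of the Hamming distances between two distinct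
codewords (and `0` if there are no two distinct codewords). -/
def minHammingDist {A : Type*} {n : ℕ} (K : Set (Fin n → A)) : ℕ :=
  sInf {d | ∃ x ∈ K, ∃ y ∈ K, x ≠ y ∧ hammingDist x y = d}

/-- The Hamming distance of an ideal of `A[x] / ⟨xⁿ - α⟩`, as a code of length `n` over `A`. -/
def dH {A : Type*} [CommRing A] {n : ℕ} {α : A} (I : Ideal (Ambient n α)) : ℕ :=
  minHammingDist (codeOfIdeal I)

/-- `α₀ = α₁ ^ (p ^ (m - r₀))`, where `r₀` is the remainder of `s` modulo `m`. -/
def alphaZero {F : Type*} [Field F] (p m s : ℕ) (α₁ : F) : F := α₁ ^ p ^ (m - s % m)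

/-- `α₀` is a `p ^ s`-th root of `α₁`. -/
theorem alphaZero_pow {F : Type*} [Field F] [Finite F] (p m s : ℕ) (hm : 0 < m)
    (hF : Nat.card F = p ^ m) (α₁ : F) : alphaZero p m s α₁ ^ p ^ s = α₁ := by
  have := Fintype.ofFinite F
  rw [Nat.card_eq_fintype_card] at hF
  have hr : s % m < m := Nat.mod_lt s hm
  have hs : m - s % m + s = m * (s / m + 1) := by
    have := Nat.div_add_mod s m
    rw [Nat.mul_add, Nat.mul_one]
    omega
  rw [alphaZero, ← pow_mul, ← pow_add, hs, pow_mul, ← hF, FiniteField.pow_card_pow]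

section Codes

variable {F : Type*} [Field F] {n : ℕ} {α : BaseRing F}

/-- The element `u` of the ambient ring `𝓡[x] / ⟨xⁿ - α⟩`. -/
def uA (n : ℕ) (α : BaseRing F) : Ambient n α :=
  AdjoinRoot.mk (X ^ n - C α : (BaseRing F)[X]) (C (uElt F))

/-- The element `x² - a` of the ambient ring `𝓡[x] / ⟨xⁿ - α⟩`, for `a ∈ F`. -/
def yA (n : ℕ) (α : BaseRing F) (a : F) : Ambient n α :=
  AdjoinRoot.mk (X ^ n - C α : (BaseRing F)[X]) (X ^ 2 - C (algebraMap F (BaseRing F) a))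

/-- The ideal `⟨u (x² - a)^k⟩`. -/
def codeB (n : ℕ) (α : BaseRing F) (a : F) (k : ℕ) : Ideal (Ambient n α) :=
  Ideal.span {uA n α * yA n α a ^ k}

/-- The ideal `⟨(x² - a)^ℓ + u (x² - a)^t z⟩`. -/
def codeC (a : F) (ℓ t : ℕ) (z : Ambient n α) : Ideal (Ambient n α) :=
  Ideal.span {yA n α a ^ ℓ + uA n α * yA n α a ^ t * z}

/-- The ideal `⟨(x² - a)^ℓ + u (x² - a)^t z, u (x² - a)^μ⟩`. -/
def codeD (a : F) (ℓ t μ : ℕ) (z : Ambient n α) : Ideal (Ambient n α) :=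
  Ideal.span {yA n α a ^ ℓ + uA n α * yA n α a ^ t * z, uA n α * yA n α a ^ μ}

/-- The smallest `j` with `u (x² - a)^j ∈ ⟨(x² - a)^ℓ + u (x² - a)^t z⟩`. -/
def torsionIndex (a : F) (ℓ t : ℕ) (z : Ambient n α) : ℕ :=
  sInf {j | uA n α * yA n α a ^ j ∈ codeC a ℓ t z}

end Codes

end ConstacyclicUV

end

/-! Write y = x² - α₀. Since α₀^(p^s) = α₁, Frobenius gives y^(p^s) = α₂u + α₃v + α₄uv, so y is
nilpotent. A square root of α₀ would lift to one of α, so x² - α₀ is irreducible and the ambient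
ring is local with maximal ideal ⟨y, u, v⟩. As α₃ is a unit, uv is a multiple of u y^(p^s), hence
every nonzero multiple of u is a unit times some u y^j (`exists_u_mul_eq`).

Reduction to ⟨u y^μ⟩ (`dH_codeD_eq`): multiplication by u does not increase weight and maps 𝒞 into
⟨u y^μ⟩. A codeword killed by u is itself u times a word, and minimality of the torsion index puts
it in ⟨u y^μ⟩.

Reduction to F: ⟨u y^(p^s + k)⟩ = ⟨uv y^k⟩, whose words for k ≤ p^s are uv·q with q over F of degree
below 2p^s and divisible by (X² - α₀)^k (`exists_eq_uvWord`). For μ ≤ p^s the constant uv is a word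
of weight 1.

Counting terms: a polynomial in characteristic p that vanishes to order exactly k at a nonzero point
has at least ∏(kᵢ + 1) terms, kᵢ being the base p digits of k (`digitWeight_le_card_support`).
Splitting by parity of exponents carries the resulting bound from X - α₀ to X² - α₀, and a suitable
power of X² - α₀ attains it (`card_support_X_sq_sub_C_pow_le`). -/

namespace ConstacyclicUV

/-! ### Splitting a polynomial by residues of its exponents -/

section Sections

variable {R : Type*} [CommRing R]

/-- The `j`-th section of `g` modulo `N`: its `n`-th coefficient is the `(n N + j)`-th one of `g`. -/
noncomputable def polySection (N j : ℕ) (g : R[X]) : R[X] := contract N (divX^[j] g)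

theorem coeff_iterate_divX (g : R[X]) (j n : ℕ) : (divX^[j] g).coeff n = g.coeff (n + j) := by
  induction j generalizing n with
  | zero => rfl
  | succ j ih => rw [Function.iterate_succ_apply', coeff_divX, ih]; congr 1; omega

theorem coeff_polySection {N : ℕ} (hN : N ≠ 0) (j : ℕ) (g : R[X]) (n : ℕ) :
    (polySection N j g).coeff n = g.coeff (n * N + j) := by
  rw [polySection, coeff_contract hN, coeff_iterate_divX]

theorem coeff_sum_X_pow_mul_expand {N : ℕ} (q : ℕ → R[X]) (n j : ℕ)
    (hj : j < N) : (∑ i ∈ Finset.range N, X ^ i * expand R N (q i)).coeff (n * N + j)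
      = (q j).coeff n := by
  have hN : 0 < N := by omega
  rw [finsetSum_coeff, Finset.sum_eq_single_of_mem j (Finset.mem_range.2 hj)]
  · rw [coeff_X_pow_mul', if_pos (by omega), Nat.add_sub_cancel, coeff_expand_mul hN]
  · intro i hi hij
    rw [Finset.mem_range] at hi
    rw [coeff_X_pow_mul']
    split_ifs with h
    · rw [coeff_expand hN, if_neg]
      rintro ⟨c, hc⟩
      have h1 : n * N + j = N * c + i := by omega
      have h2 := congrArg (· % N) h1
      simp only [Nat.mul_add_mod_self_right, Nat.mul_add_mod_self_left,
        Nat.mod_eq_of_lt hi, Nat.mod_eq_of_lt hj] at h2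
      exact hij h2.symm
    · rfl

theorem sum_polySection {N : ℕ} (hN : 0 < N) (g : R[X]) :
    ∑ i ∈ Finset.range N, X ^ i * expand R N (polySection N i g) = g := by
  ext n
  rw [← Nat.div_add_mod' n N, coeff_sum_X_pow_mul_expand _ _ _ (Nat.mod_lt n hN),
    coeff_polySection hN.ne']

/-- A polynomial in X^N does not mix residue classes of exponents, so taking sections is linear over
R[X^N]. -/
theorem polySection_expand_mul {N j : ℕ} (hj : j < N) (q h : R[X]) :
    polySection N j (expand R N q * h) = q * polySection N j h := by
  have hN : 0 < N := by omega
  ext n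
  have : expand R N q * h
      = ∑ i ∈ Finset.range N, X ^ i * expand R N (q * polySection N i h) := by
    conv_lhs => rw [← sum_polySection hN h]
    rw [Finset.mul_sum]
    refine Finset.sum_congr rfl fun i _ => ?_
    rw [map_mul]; ring
  rw [coeff_polySection hN.ne', this, coeff_sum_X_pow_mul_expand _ _ _ hj]

/-- Different sections draw their coefficients from disjoint residue classes. -/
theorem sum_card_support_polySection_le {N : ℕ} (hN : 0 < N) (g : R[X]) (J : Finset ℕ)
    (hJ : ∀ j ∈ J, j < N) : ∑ j ∈ J, (polySection N j g).support.card ≤ g.support.card := by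
  rw [← Finset.card_sigma]
  refine Finset.card_le_card_of_injOn (fun x => x.2 * N + x.1) ?_ ?_
  · rintro ⟨j, n⟩ h
    simp only [Finset.coe_sigma, Set.mem_sigma_iff, Finset.mem_coe, mem_support_iff,
      coeff_polySection hN.ne'] at h ⊢
    exact h.2
  · rintro ⟨j, n⟩ h ⟨j', n'⟩ h' he
    simp only [Finset.coe_sigma, Set.mem_sigma_iff, Finset.mem_coe] at h h' he
    have h1 := hJ j h.1
    have h2 := hJ j' h'.1
    have h3 := congrArg (· % N) he
    simp only [Nat.mul_add_mod_self_right, Nat.mod_eq_of_lt h1, Nat.mod_eq_of_lt h2] at h3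
    subst h3
    have h4 : n = n' := Nat.eq_of_mul_eq_mul_right hN (by omega)
    rw [h4]

theorem card_support_polySection_le {N j : ℕ} (hj : j < N) (g : R[X]) :
    (polySection N j g).support.card ≤ g.support.card := by
  simpa using sum_card_support_polySection_le (by omega) g {j} (by simpa using hj)

theorem exists_polySection_ne_zero {N : ℕ} (hN : 0 < N) {g : R[X]} (hg : g ≠ 0) :
    ∃ j < N, polySection N j g ≠ 0 := by
  by_contra! h
  refine hg ?_
  rw [← sum_polySection hN g]
  exact Finset.sum_eq_zero fun i hi => by rw [h i (Finset.mem_range.1 hi), map_zero, mul_zero]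

end Sections

/-! ### Digit products -/

/-- The product of the numbers `d + 1` over the base `p` digits `d` of `k`. -/
def digitWeight (p k : ℕ) : ℕ := ((p.digits k).map (· + 1)).prod

theorem digitWeight_zero (p : ℕ) : digitWeight p 0 = 1 := by simp [digitWeight]

theorem digitWeight_add {p : ℕ} (hp : 1 < p) {o : ℕ} (ho : o < p) (r : ℕ) :
    digitWeight p (o + p * r) = (o + 1) * digitWeight p r := by
  by_cases h : o ≠ 0 ∨ r ≠ 0
  · rw [digitWeight, Nat.digits_add p hp o r ho h]; rfl
  · push Not at h
    obtain ⟨rfl, rfl⟩ := h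
    simp [digitWeight_zero]

theorem one_le_digitWeight (p k : ℕ) : 1 ≤ digitWeight p k := by
  refine Nat.one_le_iff_ne_zero.2 fun h => ?_
  rw [digitWeight, List.prod_eq_zero_iff] at h
  simp at h

theorem two_le_digitWeight {p : ℕ} (hp : 1 < p) {k : ℕ} (hk : k ≠ 0) : 2 ≤ digitWeight p k := by
  induction k using Nat.strong_induction_on with
  | _ k ih =>
    have h := digitWeight_add hp (Nat.mod_lt k (by omega : p > 0)) (k / p)
    rw [Nat.mod_add_div] at h
    rw [h]
    by_cases h0 : k % p = 0
    · have h1 : k / p ≠ 0 := fun h1 => hk (by rw [← Nat.mod_add_div k p, h0, h1]; simp)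
      have := ih (k / p) (Nat.div_lt_self (by omega) hp) h1
      nlinarith [Nat.zero_le (k % p)]
    · have := one_le_digitWeight p (k / p)
      have : 1 ≤ k % p := by omega
      nlinarith

theorem digitWeight_add_pow_mul {p : ℕ} (hp : 1 < p) (e : ℕ) {r : ℕ} (hr : r < p ^ e) (q : ℕ) :
    digitWeight p (r + p ^ e * q) = digitWeight p r * digitWeight p q := by
  induction e generalizing r with
  | zero =>
    have : r = 0 := by simpa using hr
    simp [this, digitWeight_zero]
  | succ e ih =>
    have h0 : r % p < p := Nat.mod_lt _ (by omega)
    have h1 : r / p < p ^ e := Nat.div_lt_of_lt_mul (by rwa [← pow_succ'])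
    have h2 : r + p ^ (e + 1) * q = r % p + p * (r / p + p ^ e * q) := by
      conv_lhs => rw [← Nat.mod_add_div r p]
      ring
    rw [h2, digitWeight_add hp h0, ih h1, ← mul_assoc, ← digitWeight_add hp h0, Nat.mod_add_div]

theorem digitWeight_pow_sub_one {p : ℕ} (hp : 1 < p) (e : ℕ) :
    digitWeight p (p ^ e - 1) = p ^ e := by
  induction e with
  | zero => simp [digitWeight_zero]
  | succ e ih =>
    have h1 : 1 ≤ p ^ e := Nat.one_le_pow _ _ (by omega)
    have h : p ^ (e + 1) - 1 = (p - 1) + p * (p ^ e - 1) := by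
      have : p ≤ p * p ^ e := Nat.le_mul_of_pos_right _ h1
      rw [Nat.mul_sub, pow_succ']
      omega
    rw [h, digitWeight_add hp (by omega), ih, pow_succ', Nat.sub_add_cancel hp.le]

/-- A lower bound for `digitWeight` on the top segment of `[0, p ^ s)`. -/
theorem le_digitWeight {p : ℕ} (hp : 1 < p) {γ e Γ i : ℕ} (hΓ : 1 ≤ Γ)
    (hi : p ^ e * (p * (p ^ γ - 1) + (Γ - 1)) + 1 ≤ i) (hi' : i < p ^ (e + (γ + 1))) :
    (Γ + 1) * p ^ γ ≤ digitWeight p i := by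
  have he : 0 < p ^ e := pow_pos (by omega) _
  have h1 : 1 ≤ p ^ γ := Nat.one_le_pow _ _ (by omega)
  have hr : i % p ^ e < p ^ e := Nat.mod_lt _ he
  have hi2 := Nat.mod_add_div i (p ^ e)
  -- The threshold has top γ digits p - 1, then the digit Γ - 1, then e zeros. An index i above it
  -- keeps the top digits; its middle digit is Γ - 1 + d.
  set q := i / p ^ e with hq
  have hq1 : p * (p ^ γ - 1) + (Γ - 1) ≤ q :=
    (Nat.le_div_iff_mul_le he).2 (by rw [mul_comm]; omega)
  have hq2 : q < p ^ (γ + 1) := Nat.div_lt_of_lt_mul (by rwa [← pow_add])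
  obtain ⟨d, hd⟩ := Nat.exists_eq_add_of_le hq1
  have hdp : Γ - 1 + d < p := by
    have : p * (p ^ γ - 1) + p = p ^ (γ + 1) := by
      rw [Nat.mul_sub, pow_succ']
      have : p ≤ p * p ^ γ := Nat.le_mul_of_pos_right _ h1
      omega
    omega
  have hw : digitWeight p q = (Γ - 1 + d + 1) * p ^ γ := by
    have hq3 : q = Γ - 1 + d + p * (p ^ γ - 1) := by omega
    rw [hq3, digitWeight_add hp hdp, digitWeight_pow_sub_one hp]
  rw [← hi2, digitWeight_add_pow_mul hp e hr, hw]
  have hr1 := one_le_digitWeight p (i % p ^ e)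
  -- If d = 0, the low part of i is nonzero and contributes a factor at least 2, with 2Γ ≥ Γ + 1.
  -- Otherwise the middle digit alone suffices.
  rcases Nat.eq_zero_or_pos d with rfl | hd0
  · have hr0 : i % p ^ e ≠ 0 := by
      intro h0
      rw [h0, zero_add, hd] at hi2
      rw [add_zero] at hi2
      omega
    have := two_le_digitWeight hp hr0
    calc (Γ + 1) * p ^ γ ≤ 2 * ((Γ - 1 + 0 + 1) * p ^ γ) := by
          rw [← mul_assoc]; exact Nat.mul_le_mul_right _ (by omega)
      _ ≤ _ := Nat.mul_le_mul_right _ this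
  · calc (Γ + 1) * p ^ γ ≤ 1 * ((Γ - 1 + d + 1) * p ^ γ) := by
          rw [one_mul]; exact Nat.mul_le_mul_right _ (by omega)
      _ ≤ _ := Nat.mul_le_mul_right _ hr1

/-! ### Number of terms of polynomials with a root of high order -/

section Weight

variable {F : Type*} [Field F]

/-- A nonzero polynomial of degree less than the characteristic that vanishes to order `o` at a
nonzero point has more than `o` terms. -/
theorem lt_card_support_of_pow_dvd {p : ℕ} [CharP F p] {a : F} (ha : a ≠ 0) {o : ℕ} {g : F[X]}
    (hg : g ≠ 0) (hdeg : g.natDegree < p) (hdvd : (X - C a) ^ o ∣ g) : o < g.support.card := by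
  induction o generalizing g with
  | zero => exact Finset.card_pos.2 (support_nonempty.2 hg)
  | succ o ih =>
    obtain ⟨i, hi⟩ := support_nonempty.2 hg
    -- The operator X·d/dX - i deletes exactly the term of degree i, the exponents being distinct
    -- mod p, and lowers the order of vanishing by at most one.
    have hcoeff : ∀ n : ℕ, (X * derivative g - C (i : F) * g).coeff n = ((n : F) - i) * g.coeff n := by
      intro n
      rw [coeff_sub, coeff_C_mul]
      cases n with
      | zero => simp
      | succ n => rw [coeff_X_mul, coeff_derivative]; push_cast; ring
    set G := X * derivative g - C (i : F) * g with hG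
    have hsub : G.support ⊆ g.support.erase i := by
      intro n hn
      rw [mem_support_iff, hcoeff] at hn
      rw [Finset.mem_erase, mem_support_iff]
      refine ⟨?_, right_ne_zero_of_mul hn⟩
      rintro rfl
      simp at hn
    have hne : ∀ n ∈ g.support, n ≠ i → n ∈ G.support := by
      intro n hn hni
      rw [mem_support_iff, hcoeff]
      refine mul_ne_zero ?_ (mem_support_iff.1 hn)
      rw [sub_ne_zero]
      intro h
      have h1 := (CharP.natCast_eq_natCast F p).1 h
      have h2 := le_natDegree_of_mem_supp n hn
      have h3 := le_natDegree_of_mem_supp i hi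
      rw [Nat.ModEq, Nat.mod_eq_of_lt (by omega), Nat.mod_eq_of_lt (by omega)] at h1
      exact hni h1
    have hG0 : G ≠ 0 := by
      intro h0
      have hsupp : g.support = {i} := by
        refine Finset.eq_singleton_iff_unique_mem.2 ⟨hi, fun n hn => ?_⟩
        by_contra hni
        have := hne n hn hni
        rw [h0] at this
        simp at this
      have hmon := (card_support_le_one_iff_monomial).1 (by rw [hsupp]; simp : g.support.card ≤ 1)
      obtain ⟨n, c, rfl⟩ := hmon
      have hev : (monomial n c).eval a = 0 :=
        dvd_iff_isRoot.1 ((dvd_pow_self _ (Nat.succ_ne_zero o)).trans hdvd)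
      rw [eval_monomial] at hev
      rcases mul_eq_zero.1 hev with h | h
      · exact hg (by rw [h, map_zero])
      · exact ha (eq_zero_of_pow_eq_zero h)
    have hGdvd : (X - C a) ^ o ∣ G := by
      have h1 : (X - C a) ^ (o + 1 - 1) ∣ derivative g :=
        pow_sub_one_dvd_derivative_of_pow_dvd (p := g) (q := X - C a) (n := o + 1) hdvd
      rw [Nat.add_sub_cancel] at h1
      have h2 : (X - C a) ^ o ∣ g := (pow_dvd_pow _ o.le_succ).trans hdvd
      exact dvd_sub (Dvd.dvd.mul_left h1 X) (Dvd.dvd.mul_left h2 (C (i : F)))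
    have hGdeg : G.natDegree < p := by
      refine lt_of_le_of_lt (natDegree_le_iff_coeff_eq_zero.2 fun n hn => ?_) hdeg
      rw [hcoeff, coeff_eq_zero_of_natDegree_lt hn, mul_zero]
    have h1 := ih hG0 hGdeg hGdvd
    have h2 := Finset.card_le_card hsub
    rw [Finset.card_erase_of_mem hi] at h2
    omega

/-- A polynomial over a field of characteristic `p` that vanishes to order exactly `k` at a nonzero
point has at least `digitWeight p k` terms. -/
theorem digitWeight_le_card_support {p : ℕ} [Fact p.Prime] [CharP F p] (k : ℕ) {a : F}
    (ha : a ≠ 0) {h : F[X]} (hh : h.eval a ≠ 0) :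
    digitWeight p k ≤ ((X - C a) ^ k * h).support.card := by
  have hp : p.Prime := Fact.out
  induction k using Nat.strong_induction_on generalizing a h with
  | _ k ih =>
    rcases Nat.eq_zero_or_pos k with rfl | hk
    · rw [digitWeight_zero, pow_zero, one_mul]
      refine Finset.card_pos.2 (support_nonempty.2 ?_)
      rintro rfl
      simp at hh
    have hk2 := Nat.mod_add_div k p
    set o := k % p with ho
    set r := k / p with hr
    have hop : o < p := Nat.mod_lt _ hp.pos
    have hrk : r < k := Nat.div_lt_self hk hp.one_lt
    set H := (X - C a) ^ o * h with hH
    have hXp : (X - C a) ^ p = expand F p (X - C (a ^ p)) := by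
      rw [sub_pow_char, map_sub, expand_X, expand_C, C_pow]
    have hg : (X - C a) ^ k * h = expand F p ((X - C (a ^ p)) ^ r) * H := by
      rw [map_pow, ← hXp, hH, ← mul_assoc, ← pow_mul, ← pow_add, add_comm, hk2]
    -- L is the remainder of H modulo X^p - a^p = (X - a)^p, so it still vanishes to order exactly o
    -- < p. Its more than o terms mark sections of H that are nonzero at a^p; induction with r
    -- applies to each.
    set L : F[X] := ∑ i ∈ Finset.range p, X ^ i * C ((polySection p i H).eval (a ^ p)) with hL
    have hLcoeff : ∀ n, L.coeff n = if n < p then (polySection p n H).eval (a ^ p) else 0 := by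
      intro n
      simp only [hL, finsetSum_coeff, coeff_X_pow_mul', coeff_C]
      split_ifs with hn
      · rw [Finset.sum_eq_single_of_mem n (Finset.mem_range.2 hn)]
        · simp
        · intro b _ hbn
          split_ifs <;> first | rfl | omega
      · refine Finset.sum_eq_zero fun b hb => ?_
        rw [Finset.mem_range] at hb
        split_ifs <;> first | rfl | omega
    have hHL : (X - C a) ^ p ∣ H - L := by
      conv_rhs => rw [← sum_polySection hp.pos H]
      rw [hL, ← Finset.sum_sub_distrib]
      refine Finset.dvd_sum fun i _ => ?_
      rw [← mul_sub, hXp, ← expand_C p (eval _ _), ← map_sub]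
      exact Dvd.dvd.mul_left (map_dvd _ X_sub_C_dvd_sub_C_eval) _
    have hXa : (X - C a) ^ o ∣ L := by
      have := dvd_sub (Dvd.intro _ rfl : (X - C a) ^ o ∣ H) ((pow_dvd_pow _ hop.le).trans hHL)
      simpa using this
    have hL0 : L ≠ 0 := by
      intro h0
      rw [h0, sub_zero] at hHL
      have h1 := (pow_dvd_pow (X - C a) (Nat.succ_le_of_lt hop)).trans hHL
      rw [hH, Nat.succ_eq_add_one, pow_succ] at h1
      exact hh (dvd_iff_isRoot.1 ((mul_dvd_mul_iff_left (pow_ne_zero _ (X_sub_C_ne_zero a))).1 h1))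
    have hLdeg : L.natDegree < p := by
      rw [natDegree_lt_iff_degree_lt hL0, degree_lt_iff_coeff_zero]
      intro n hn
      rw [hLcoeff, if_neg (by omega)]
    have hcard := lt_card_support_of_pow_dvd ha hL0 hLdeg hXa
    have hmem : ∀ j ∈ L.support, j < p ∧ (polySection p j H).eval (a ^ p) ≠ 0 := by
      intro j hj
      rw [mem_support_iff, hLcoeff] at hj
      split_ifs at hj with h
      · exact ⟨h, hj⟩
      · exact absurd rfl hj
    rw [hg]
    refine le_trans ?_ (sum_card_support_polySection_le hp.pos _ L.support fun j hj => (hmem j hj).1)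
    calc digitWeight p k = (o + 1) * digitWeight p r := by
          rw [← digitWeight_add hp.one_lt hop, hk2]
      _ ≤ L.support.card * digitWeight p r := Nat.mul_le_mul_right _ hcard
      _ = ∑ _j ∈ L.support, digitWeight p r := by rw [Finset.sum_const, smul_eq_mul]
      _ ≤ _ := Finset.sum_le_sum fun j hj => by
        rw [polySection_expand_mul (hmem j hj).1]
        exact ih r hrk (pow_ne_zero _ ha) (hmem j hj).2

theorem le_card_support_of_X_sub_C_pow_dvd {p : ℕ} [Fact p.Prime] [CharP F p] {a : F} (ha : a ≠ 0)
    {γ e Γ : ℕ} (hΓ : 1 ≤ Γ) {g : F[X]} (hg : g ≠ 0)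
    (hdeg : g.natDegree < p ^ (e + (γ + 1)))
    (hdvd : (X - C a) ^ (p ^ e * (p * (p ^ γ - 1) + (Γ - 1)) + 1) ∣ g) :
    (Γ + 1) * p ^ γ ≤ g.support.card := by
  have hp : p.Prime := Fact.out
  obtain ⟨h, hgh, hh⟩ := exists_eq_pow_rootMultiplicity_mul_and_not_dvd g hg a
  rw [dvd_iff_isRoot] at hh
  refine le_trans (le_digitWeight hp.one_lt hΓ ((le_rootMultiplicity_iff hg).2 hdvd) ?_)
    ((digitWeight_le_card_support (g.rootMultiplicity a) ha hh).trans_eq (by rw [← hgh]))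
  refine lt_of_le_of_lt ?_ hdeg
  have := natDegree_le_of_dvd (pow_rootMultiplicity_dvd g a) hg
  rwa [natDegree_pow, natDegree_X_sub_C, mul_one] at this

/-- X² - a is X - a evaluated at X², so the even and odd sections of g are divisible by the same
power of X - a and have half the degree bound. -/
theorem le_card_support_of_X_sq_sub_C_pow_dvd {p : ℕ} [Fact p.Prime] [CharP F p] {a : F}
    (ha : a ≠ 0) {γ e Γ : ℕ} (hΓ : 1 ≤ Γ) {g : F[X]} (hg : g ≠ 0)
    (hdeg : g.natDegree < 2 * p ^ (e + (γ + 1)))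
    (hdvd : (X ^ 2 - C a) ^ (p ^ e * (p * (p ^ γ - 1) + (Γ - 1)) + 1) ∣ g) :
    (Γ + 1) * p ^ γ ≤ g.support.card := by
  obtain ⟨j, hj, hj0⟩ := exists_polySection_ne_zero (N := 2) (by norm_num) hg
  refine le_trans (le_card_support_of_X_sub_C_pow_dvd (e := e) ha hΓ hj0 ?_ ?_)
    (card_support_polySection_le hj g)
  · rw [natDegree_lt_iff_degree_lt hj0, degree_lt_iff_coeff_zero]
    intro n hn
    rw [coeff_polySection (by norm_num)]
    exact coeff_eq_zero_of_natDegree_lt (by omega)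
  · obtain ⟨q, rfl⟩ := hdvd
    have : (X ^ 2 - C a : F[X]) = expand F 2 (X - C a) := by rw [map_sub, expand_X, expand_C]
    rw [this, ← map_pow, polySection_expand_mul hj]
    exact Dvd.intro _ rfl

theorem card_support_mul_le (f g : F[X]) :
    (f * g).support.card ≤ f.support.card * g.support.card := by
  rw [← Finset.card_product]
  refine (Finset.card_le_card (t := (f.support ×ˢ g.support).image fun x => x.1 + x.2) ?_).trans
    Finset.card_image_le
  intro n hn
  rw [mem_support_iff, coeff_mul] at hn
  obtain ⟨x, hx, hx0⟩ := Finset.exists_ne_zero_of_sum_ne_zero hn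
  refine Finset.mem_image.2 ⟨x, Finset.mem_product.2 ⟨?_, ?_⟩, Finset.HasAntidiagonal.mem_antidiagonal.1 hx⟩
  · exact mem_support_iff.2 (left_ne_zero_of_mul hx0)
  · exact mem_support_iff.2 (right_ne_zero_of_mul hx0)

theorem card_support_expand_le (N : ℕ) (hN : 0 < N) (f : F[X]) :
    (expand F N f).support.card ≤ f.support.card := by
  refine (Finset.card_le_card (t := f.support.image (· * N)) fun n hn => ?_).trans
    Finset.card_image_le
  rw [mem_support_iff, coeff_expand hN] at hn
  split_ifs at hn with h
  · exact Finset.mem_image.2 ⟨n / N, mem_support_iff.2 hn, Nat.div_mul_cancel h⟩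
  · exact absurd rfl hn

theorem card_support_le_of_natDegree_lt {f : F[X]} {n : ℕ} (h : f.natDegree < n) :
    f.support.card ≤ n := by
  have := Finset.card_le_card (supp_subset_range h)
  rwa [Finset.card_range] at this

/-- The power of `X² - a` that attains the minimum number of terms. -/
theorem card_support_X_sq_sub_C_pow_le {p : ℕ} [Fact p.Prime] [CharP F p] (a : F) (γ e Γ : ℕ) :
    ((X ^ 2 - C a : F[X]) ^ (p ^ e * (p * (p ^ γ - 1) + Γ))).support.card ≤ (Γ + 1) * p ^ γ := by
  have hp : p.Prime := Fact.out
  -- By Frobenius this power is an n-th power of a binomial in X^(2p^d), so it has at most n + 1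
  -- terms. The exponent splits into d = e + 1, n = p^γ - 1 and d = e, n = Γ.
  have key : ∀ d n : ℕ, (X ^ 2 - C a : F[X]) ^ (p ^ d * n)
      = expand F (2 * p ^ d) ((X - C (a ^ p ^ d)) ^ n) := by
    intro d n
    rw [pow_mul, sub_pow_char_pow, map_pow, map_sub, expand_X, expand_C, C_pow, pow_mul]
  have hpos : ∀ d, 0 < 2 * p ^ d := fun d => Nat.mul_pos (by norm_num) (pow_pos hp.pos _)
  have hdeg : ∀ (b : F) (n : ℕ), ((X - C b) ^ n).natDegree < n + 1 := by
    intro b n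
    rw [natDegree_pow, natDegree_X_sub_C, mul_one]; omega
  have hsplit : p ^ e * (p * (p ^ γ - 1) + Γ) = p ^ (e + 1) * (p ^ γ - 1) + p ^ e * Γ := by ring
  rw [hsplit, pow_add, key, key, mul_comm (Γ + 1)]
  refine (card_support_mul_le _ _).trans (Nat.mul_le_mul ?_ ?_)
  · refine (card_support_expand_le _ (hpos _) _).trans ?_
    have := card_support_le_of_natDegree_lt (hdeg (a ^ p ^ (e + 1)) (p ^ γ - 1))
    rwa [Nat.sub_add_cancel (Nat.one_le_pow _ _ hp.pos)] at this
  · exact (card_support_expand_le _ (hpos _) _).trans (card_support_le_of_natDegree_lt (hdeg _ _))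

end Weight

/-! ### Multiples of u in a local ring with maximal ideal ⟨y, u, v⟩ -/

section LocalRing

variable {A : Type*} [CommRing A] {u v y c₂ c₃ c₄ d : A} {N : ℕ}

theorem pow_eq_zero_of_eq (hu : u ^ 2 = 0) (hv : v ^ 2 = 0)
    (hy : y ^ N = c₂ * u + c₃ * v + c₄ * (u * v)) : y ^ (N * 3) = 0 := by
  rw [pow_mul, hy]
  linear_combination ((c₂ + c₄ * v) ^ 3 * u + 3 * (c₂ + c₄ * v) ^ 2 * c₃ * v) * hu
    + (3 * (c₂ + c₄ * v) * u * c₃ ^ 2 + c₃ ^ 3 * v) * hv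

theorem u_mul_pow_eq_zero (hu : u ^ 2 = 0) (hv : v ^ 2 = 0)
    (hy : y ^ N = c₂ * u + c₃ * v + c₄ * (u * v)) : u * y ^ (N * 2) = 0 := by
  rw [pow_mul, hy]
  linear_combination ((c₂ + c₄ * v) ^ 2 * u + 2 * (c₂ + c₄ * v) * c₃ * v) * hu
    + (c₃ ^ 2 * u) * hv

/-- Multiplying y^N by u leaves only c₃uv, and c₃ is invertible. -/
theorem u_mul_v_eq (hu : u ^ 2 = 0) (hy : y ^ N = c₂ * u + c₃ * v + c₄ * (u * v))
    (hd : c₃ * d = 1) : u * v = d * (u * y ^ N) := by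
  rw [hy]
  linear_combination (-u * v) * hd + (-d * c₂ - d * c₄ * v) * hu

/-- Every nonzero multiple of `u` is a unit times some `u yʲ`. -/
theorem exists_u_mul_eq (hN : 0 < N) (hu : u ^ 2 = 0) (hv : v ^ 2 = 0)
    (hy : y ^ N = c₂ * u + c₃ * v + c₄ * (u * v)) (hd : c₃ * d = 1)
    (hloc : ∀ w : A, IsUnit w ∨ ∃ b a a', w = y * b + u * a + v * a') (w : A) :
    u * w = 0 ∨ ∃ j e, IsUnit e ∧ u * w = u * y ^ j * e := by
  -- While the cofactor is not a unit, another y can be extracted: u² = 0, and uv is a multiple of u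
  -- y^N with N > 0. At exponent 2N the product vanishes.
  have key : ∀ k, (∃ w', u * w = u * y ^ k * w') ∨ ∃ j e, IsUnit e ∧ u * w = u * y ^ j * e := by
    intro k
    induction k with
    | zero => exact Or.inl ⟨w, by ring⟩
    | succ k ih =>
      rcases ih with ⟨w', hw'⟩ | h
      · rcases hloc w' with he | ⟨b, a, a', rfl⟩
        · exact Or.inr ⟨k, w', he, hw'⟩
        · left
          obtain ⟨M, rfl⟩ := Nat.exists_eq_succ_of_ne_zero hN.ne'
          refine ⟨b + d * y ^ M * a', ?_⟩
          have huv := u_mul_v_eq hu hy hd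
          rw [Nat.succ_eq_add_one, pow_succ] at huv
          rw [hw']
          linear_combination (y ^ k * a) * hu + (y ^ k * a') * huv
      · exact Or.inr h
  rcases key (N * 2) with ⟨w', hw'⟩ | h
  · left
    rw [hw', u_mul_pow_eq_zero hu hv hy, zero_mul]
  · exact Or.inr h

theorem u_mul_mem_span_of_mem_span_pair (hN : 0 < N) (hu : u ^ 2 = 0) (hv : v ^ 2 = 0)
    (hy : y ^ N = c₂ * u + c₃ * v + c₄ * (u * v)) (hd : c₃ * d = 1)
    (hloc : ∀ w : A, IsUnit w ∨ ∃ b a a', w = y * b + u * a + v * a') {g : A} {μ : ℕ}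
    (hμ : ∀ j, u * y ^ j ∈ Ideal.span {g} → μ ≤ j) {w : A}
    (hw : u * w ∈ Ideal.span {g, u * y ^ μ}) : u * w ∈ Ideal.span {u * y ^ μ} := by
  rcases exists_u_mul_eq hN hu hv hy hd hloc w with h | ⟨j, e, he, hj⟩
  · rw [h]; exact zero_mem _
  rw [Ideal.mem_span_singleton]
  by_cases hjμ : μ ≤ j
  · rw [hj]
    exact (mul_dvd_mul_left _ (pow_dvd_pow _ hjμ)).mul_right _
  -- For j < μ, moving the multiple of u y^μ to the left leaves u y^j times a unit minus a
  -- nilpotent. That is again a unit, so u y^j ∈ ⟨g⟩, against the bound on μ.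
  · exfalso
    obtain ⟨f, h, hfh⟩ := Ideal.mem_span_pair.1 hw
    obtain ⟨i, rfl⟩ := Nat.exists_eq_add_of_lt (not_le.1 hjμ)
    have hnil : IsNilpotent (y ^ (i + 1) * h) := by
      refine (Commute.all _ _).isNilpotent_mul_right ?_
      exact IsNilpotent.pow_succ i ⟨_, pow_eq_zero_of_eq hu hv hy⟩
    have hunit : IsUnit (e - y ^ (i + 1) * h) := by
      rw [sub_eq_add_neg, add_comm]
      exact hnil.neg.isUnit_add_right_of_commute he (Commute.all _ _)
    obtain ⟨e', he'⟩ := hunit.exists_right_inv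
    have hmem : u * y ^ j ∈ Ideal.span {g} := by
      rw [Ideal.mem_span_singleton]
      refine ⟨f * e', ?_⟩
      linear_combination (u * y ^ j) * (-he') + e' * (-hj - hfh)
    have := hμ j hmem
    omega

end LocalRing

/-! ### Coordinates in the base ring -/

section BaseRingFacts

variable {F : Type*} [Field F]

theorem uElt_sq : uElt F ^ 2 = 0 := by
  rw [uElt, ← map_pow, Ideal.Quotient.eq_zero_iff_mem]
  exact Ideal.subset_span (by simp)

theorem vElt_sq : vElt F ^ 2 = 0 := by
  rw [vElt, ← map_pow, Ideal.Quotient.eq_zero_iff_mem]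
  exact Ideal.subset_span (by simp)

theorem exists_elt_eq (r : BaseRing F) : ∃ a b c d : F, r = elt a b c d := by
  obtain ⟨P, rfl⟩ := Ideal.Quotient.mk_surjective r
  induction P using MvPolynomial.induction_on with
  | C a => exact ⟨a, 0, 0, 0, by simp [elt]; rfl⟩
  | add P Q hP hQ =>
    obtain ⟨a, b, c, d, h⟩ := hP
    obtain ⟨a', b', c', d', h'⟩ := hQ
    refine ⟨a + a', b + b', c + c', d + d', ?_⟩
    rw [map_add, h, h']
    simp only [elt, map_add]
    ring
  | mul_X P i hP =>
    obtain ⟨a, b, c, d, h⟩ := hP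
    rw [map_mul, h]
    fin_cases i
    · refine ⟨0, a, 0, c, ?_⟩
      change elt a b c d * uElt F = _
      simp only [elt, map_zero]
      linear_combination (algebraMap F (BaseRing F) b + algebraMap F (BaseRing F) d * vElt F)
        * uElt_sq (F := F)
    · refine ⟨0, 0, a, b, ?_⟩
      change elt a b c d * vElt F = _
      simp only [elt, map_zero]
      linear_combination (algebraMap F (BaseRing F) c + algebraMap F (BaseRing F) d * uElt F)
        * vElt_sq (F := F)

/-- The model of the base ring as dual numbers over dual numbers. -/
noncomputable def toDualDual (F : Type*) [Field F] :
    BaseRing F →+* DualNumber (DualNumber F) :=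
  Ideal.Quotient.lift _ (MvPolynomial.aeval
    ![(DualNumber.eps : DualNumber (DualNumber F)),
      TrivSqZeroExt.inl (DualNumber.eps : DualNumber F)] : _ →ₐ[F] _).toRingHom (by
    intro a ha
    induction ha using Submodule.span_induction with
    | mem x hx =>
      rcases hx with rfl | rfl | rfl
      · simp
      · simp
      · simp [mul_comm]
    | zero => simp
    | add x y _ _ hx hy => rw [map_add, hx, hy, add_zero]
    | smul a x _ hx => rw [smul_eq_mul, map_mul, hx, mul_zero])

theorem toDualDual_elt (a b c d : F) : toDualDual F (elt a b c d)
    = TrivSqZeroExt.inl (TrivSqZeroExt.inl a + TrivSqZeroExt.inr c)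
      + TrivSqZeroExt.inr (TrivSqZeroExt.inl b + TrivSqZeroExt.inr d) := by
  have hu : toDualDual F (uElt F) = DualNumber.eps := by simp [toDualDual, uElt]
  have hv : toDualDual F (vElt F) = TrivSqZeroExt.inl DualNumber.eps := by
    simp [toDualDual, vElt]
  have hκ : ∀ a : F, toDualDual F (algebraMap F (BaseRing F) a)
      = TrivSqZeroExt.inl (TrivSqZeroExt.inl a) := by
    intro a
    have : algebraMap F (BaseRing F) a = Ideal.Quotient.mk _ (MvPolynomial.C a) := rfl
    rw [this, toDualDual, Ideal.Quotient.lift_mk]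
    simp
    rfl
  simp only [elt, map_add, map_mul, hu, hv, hκ]
  ext <;> simp

/-- The four coordinates can be read off in the iterated dual numbers. -/
theorem elt_injective {a b c d a' b' c' d' : F} (h : elt a b c d = elt a' b' c' d') :
    a = a' ∧ b = b' ∧ c = c' ∧ d = d' := by
  have h1 := congrArg (toDualDual F) h
  rw [toDualDual_elt, toDualDual_elt] at h1
  have hf := congrArg TrivSqZeroExt.fst h1
  have hs := congrArg TrivSqZeroExt.snd h1
  simp only [TrivSqZeroExt.fst_add, TrivSqZeroExt.snd_add, TrivSqZeroExt.fst_inl,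
    TrivSqZeroExt.snd_inl, TrivSqZeroExt.fst_inr, TrivSqZeroExt.snd_inr, zero_add,
    add_zero] at hf hs
  have hff := congrArg TrivSqZeroExt.fst hf
  have hfs := congrArg TrivSqZeroExt.snd hf
  have hsf := congrArg TrivSqZeroExt.fst hs
  have hss := congrArg TrivSqZeroExt.snd hs
  simp only [TrivSqZeroExt.fst_add, TrivSqZeroExt.snd_add, TrivSqZeroExt.fst_inl,
    TrivSqZeroExt.snd_inl, TrivSqZeroExt.fst_inr, TrivSqZeroExt.snd_inr, zero_add,
    add_zero] at hff hfs hsf hss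
  exact ⟨hff, hsf, hfs, hss⟩

theorem uv_mul_algebraMap_eq_zero_iff {a : F} :
    uElt F * vElt F * algebraMap F (BaseRing F) a = 0 ↔ a = 0 := by
  constructor
  · intro h
    refine (elt_injective (a := (0 : F)) (b := 0) (c := 0) (d := a) (a' := 0) (b' := 0) (c' := 0)
      (d' := 0) ?_).2.2.2
    simp only [elt, map_zero]
    linear_combination h
  · rintro rfl
    simp

theorem exists_eq_u_mul_of_u_mul_eq_zero {r : BaseRing F} (h : uElt F * r = 0) :
    ∃ r', r = uElt F * r' := by
  obtain ⟨a, b, c, d, rfl⟩ := exists_elt_eq r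
  have h0 : elt 0 a 0 c = elt (0 : F) 0 0 0 := by
    rw [elt] at h
    simp only [elt, map_zero]
    linear_combination h - (algebraMap F (BaseRing F) b + algebraMap F (BaseRing F) d * vElt F)
      * uElt_sq (F := F)
  obtain ⟨-, rfl, -, rfl⟩ := elt_injective h0
  refine ⟨algebraMap F (BaseRing F) b + algebraMap F (BaseRing F) d * vElt F, ?_⟩
  simp only [elt, map_zero]
  ring

/-- A Hensel lift: as 2b is invertible, comparing the coefficients of u, v and uv determines the
remaining coordinates of a root. -/
theorem isSquare_elt [NeZero (2 : F)] {a b : F} (hb : b ≠ 0) (hab : a = b * b) (a₂ a₃ a₄ : F) :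
    IsSquare (elt a a₂ a₃ a₄) := by
  have h2 : (2 : F) ≠ 0 := NeZero.ne 2
  set κ := algebraMap F (BaseRing F) with hκ
  set b₂ := a₂ / (2 * b)
  set b₃ := a₃ / (2 * b)
  set b₄ := (a₄ - 2 * b₂ * b₃) / (2 * b)
  have e2 : κ a₂ = 2 * κ b * κ b₂ := by
    have : a₂ = 2 * b * b₂ := by simp only [b₂]; field_simp
    conv_lhs => rw [this]
    simp only [map_mul, map_ofNat]
  have e3 : κ a₃ = 2 * κ b * κ b₃ := by
    have : a₃ = 2 * b * b₃ := by simp only [b₃]; field_simp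
    conv_lhs => rw [this]
    simp only [map_mul, map_ofNat]
  have e4 : κ a₄ = 2 * κ b * κ b₄ + 2 * κ b₂ * κ b₃ := by
    have : a₄ = 2 * b * b₄ + 2 * b₂ * b₃ := by simp only [b₄]; field_simp; ring
    conv_lhs => rw [this]
    simp only [map_mul, map_add, map_ofNat]
  refine ⟨elt b b₂ b₃ b₄, ?_⟩
  rw [elt, elt, ← hκ, e2, e3, e4, hab, map_mul]
  linear_combination (-(κ b₂ + κ b₄ * vElt F) ^ 2) * uElt_sq (F := F)
    + (-κ b₃ ^ 2 - 2 * κ b₃ * κ b₄ * uElt F) * vElt_sq (F := F)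

theorem exists_map_add_eq (P : (BaseRing F)[X]) : ∃ (f : F[X]) (a b : (BaseRing F)[X]),
    P = f.map (algebraMap F (BaseRing F)) + C (uElt F) * a + C (vElt F) * b := by
  induction P using Polynomial.induction_on' with
  | add P Q hP hQ =>
    obtain ⟨f, a, b, rfl⟩ := hP
    obtain ⟨f', a', b', rfl⟩ := hQ
    refine ⟨f + f', a + a', b + b', ?_⟩
    rw [Polynomial.map_add]
    ring
  | monomial n r =>
    obtain ⟨a, b, c, d, rfl⟩ := exists_elt_eq r
    refine ⟨monomial n a, monomial n (algebraMap F _ b + algebraMap F _ d * vElt F),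
      monomial n (algebraMap F _ c), ?_⟩
    rw [map_monomial, C_mul_monomial, C_mul_monomial, ← map_add, ← map_add, elt]
    congr 1
    ring

end BaseRingFacts

/-! ### Codewords as polynomials and minimum weights -/

section Words

variable {A : Type*} [CommRing A] {n : ℕ} {α : A}

/-- The polynomial `c₀ + c₁ x + ⋯ + cₙ₋₁ xⁿ⁻¹`. -/
noncomputable def wordPoly (c : Fin n → A) : A[X] := ∑ i : Fin n, C (c i) * X ^ (i : ℕ)

theorem coeff_wordPoly (c : Fin n → A) (k : ℕ) :
    (wordPoly c).coeff k = if h : k < n then c ⟨k, h⟩ else 0 := by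
  simp only [wordPoly, finsetSum_coeff, coeff_C_mul_X_pow]
  split_ifs with h
  · rw [Finset.sum_eq_single_of_mem ⟨k, h⟩ (Finset.mem_univ _)]
    · simp
    · intro b _ hb
      rw [if_neg]
      rintro rfl
      exact hb rfl
  · refine Finset.sum_eq_zero fun i _ => if_neg ?_
    have := i.2
    omega

theorem degree_wordPoly_lt (c : Fin n → A) : (wordPoly c).degree < n := by
  rw [degree_lt_iff_coeff_zero]
  intro k hk
  rw [coeff_wordPoly, dif_neg (by omega)]

theorem wordPoly_add (c c' : Fin n → A) : wordPoly (c + c') = wordPoly c + wordPoly c' := by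
  ext k
  rw [coeff_add, coeff_wordPoly, coeff_wordPoly, coeff_wordPoly]
  split_ifs <;> simp

theorem wordPoly_smul (r : A) (c : Fin n → A) : wordPoly (r • c) = C r * wordPoly c := by
  ext k
  rw [coeff_C_mul, coeff_wordPoly, coeff_wordPoly]
  split_ifs <;> simp

theorem wordPoly_zero : wordPoly (0 : Fin n → A) = 0 := by
  simp [wordPoly]

theorem mem_codeOfIdeal {I : Ideal (Ambient n α)} {c : Fin n → A} :
    c ∈ codeOfIdeal I ↔ AdjoinRoot.mk (X ^ n - C α : A[X]) (wordPoly c) ∈ I := Iff.rfl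

theorem eq_of_mk_eq_of_degree_lt [Nontrivial A] (hn : n ≠ 0) {f g : A[X]} (hf : f.degree < n)
    (hg : g.degree < n)
    (h : AdjoinRoot.mk (X ^ n - C α : A[X]) f = AdjoinRoot.mk (X ^ n - C α : A[X]) g) : f = g := by
  rw [AdjoinRoot.mk_eq_mk] at h
  by_contra hne
  refine (monic_X_pow_sub_C α hn).not_dvd_of_degree_lt (sub_ne_zero.2 hne) ?_ h
  rw [degree_X_pow_sub_C (Nat.pos_of_ne_zero hn)]
  exact (degree_sub_le _ _).trans_lt (max_lt hf hg)

open Classical in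
theorem exists_pair_iff (I : Ideal (Ambient n α)) (d : ℕ) :
    (∃ x ∈ codeOfIdeal I, ∃ y ∈ codeOfIdeal I, x ≠ y ∧ hammingDist x y = d)
      ↔ ∃ c ∈ codeOfIdeal I, c ≠ 0 ∧ hammingNorm c = d := by
  constructor
  · rintro ⟨x, hx, y, hy, hne, rfl⟩
    refine ⟨-x + y, ?_, ?_, (hammingDist_eq_hammingNorm x y).symm⟩
    · rw [mem_codeOfIdeal] at *
      have : wordPoly (-x + y) = wordPoly y - wordPoly x := by
        have h := wordPoly_smul (-1) x
        rw [neg_one_smul, map_neg, C_1] at h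
        rw [wordPoly_add, h]
        ring
      rw [this, map_sub]
      exact sub_mem hy hx
    · rwa [ne_eq, neg_add_eq_zero]
  · rintro ⟨c, hc, hc0, rfl⟩
    refine ⟨0, ?_, c, hc, hc0.symm, by rw [hammingDist_zero_left]⟩
    rw [mem_codeOfIdeal, wordPoly_zero, map_zero]
    exact zero_mem _

open Classical in
theorem dH_eq_sInf (I : Ideal (Ambient n α)) :
    dH I = sInf {d | ∃ c ∈ codeOfIdeal I, c ≠ 0 ∧ hammingNorm c = d} := by
  rw [dH, minHammingDist]
  congr 1
  ext d
  exact exists_pair_iff I d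

open Classical in
theorem dH_eq_of_le {I J : Ideal (Ambient n α)} (hJI : J ≤ I)
    (h : ∀ c ∈ codeOfIdeal I, c ≠ 0 →
      ∃ c' ∈ codeOfIdeal J, c' ≠ 0 ∧ hammingNorm c' ≤ hammingNorm c) : dH I = dH J := by
  rw [dH_eq_sInf, dH_eq_sInf]
  set S := {d | ∃ c ∈ codeOfIdeal I, c ≠ 0 ∧ hammingNorm c = d} with hS
  set T := {d | ∃ c ∈ codeOfIdeal J, c ≠ 0 ∧ hammingNorm c = d} with hT
  have hTS : T ⊆ S := fun d ⟨c, hc, hc0, hd⟩ => ⟨c, hJI hc, hc0, hd⟩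
  -- Without nonzero words both infima take the default value 0.
  rcases Set.eq_empty_or_nonempty S with hS0 | hSne
  · rw [hS0] at hTS ⊢
    rw [Set.subset_empty_iff.1 hTS]
  · obtain ⟨c, hc, hc0, hd⟩ := Nat.sInf_mem hSne
    obtain ⟨c', hc', hc'0, hle⟩ := h c hc hc0
    have hmem : hammingNorm c' ∈ T := ⟨c', hc', hc'0, rfl⟩
    refine le_antisymm (Nat.sInf_le (hTS (Nat.sInf_mem ⟨_, hmem⟩))) ?_
    exact (Nat.sInf_le hmem).trans (hle.trans_eq hd)

open Classical in
theorem dH_eq_of_bounds {I : Ideal (Ambient n α)} {d : ℕ}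
    (hle : ∃ c ∈ codeOfIdeal I, c ≠ 0 ∧ hammingNorm c ≤ d)
    (hge : ∀ c ∈ codeOfIdeal I, c ≠ 0 → d ≤ hammingNorm c) : dH I = d := by
  obtain ⟨c, hc, hc0, hcd⟩ := hle
  rw [dH_eq_sInf]
  have hmem : hammingNorm c ∈ {d | ∃ c ∈ codeOfIdeal I, c ≠ 0 ∧ hammingNorm c = d} :=
    ⟨c, hc, hc0, rfl⟩
  refine le_antisymm ((Nat.sInf_le hmem).trans hcd) ?_
  obtain ⟨c', hc', hc'0, hd⟩ := Nat.sInf_mem ⟨_, hmem⟩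
  rw [← hd]
  exact hge c' hc' hc'0

end Words

/-! ### The ambient ring and the two reductions -/

section AmbientFacts

variable {F : Type*} [Field F] {n : ℕ} {α : BaseRing F}

/-- The element `v` of the ambient ring. -/
noncomputable def vA (n : ℕ) (α : BaseRing F) : Ambient n α :=
  AdjoinRoot.mk (X ^ n - C α : (BaseRing F)[X]) (C (vElt F))

theorem uA_sq : uA n α ^ 2 = 0 := by
  rw [uA, ← map_pow, ← C_pow, uElt_sq, C_0, map_zero]

theorem vA_sq : vA n α ^ 2 = 0 := by
  rw [vA, ← map_pow, ← C_pow, vElt_sq, C_0, map_zero]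

theorem yA_eq_mk_map (a : F) : yA n α a = AdjoinRoot.mk (X ^ n - C α : (BaseRing F)[X])
    ((X ^ 2 - C a : F[X]).map (algebraMap F (BaseRing F))) := by
  simp [yA]

theorem X_sq_sub_C_pow {p : ℕ} [Fact p.Prime] [CharP F p] (s : ℕ) {a a₁ : F}
    (ha : a ^ p ^ s = a₁) : (X ^ 2 - C a : F[X]) ^ p ^ s = X ^ (2 * p ^ s) - C a₁ := by
  rw [sub_pow_char_pow, ← pow_mul, ← C_pow, ha]

theorem yA_pow {p s : ℕ} [Fact p.Prime] [CharP F p] {α : BaseRing F} {a a₁ a₂ a₃ a₄ : F}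
    (ha : a ^ p ^ s = a₁) (hα : α = elt a₁ a₂ a₃ a₄) :
    yA (2 * p ^ s) α a ^ p ^ s
      = AdjoinRoot.mk _ (C (algebraMap F (BaseRing F) a₂)) * uA (2 * p ^ s) α
        + AdjoinRoot.mk _ (C (algebraMap F (BaseRing F) a₃)) * vA (2 * p ^ s) α
        + AdjoinRoot.mk _ (C (algebraMap F (BaseRing F) a₄))
          * (uA (2 * p ^ s) α * vA (2 * p ^ s) α) := by
  rw [yA_eq_mk_map, ← map_pow, ← Polynomial.map_pow, X_sq_sub_C_pow s ha, uA, vA]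
  simp only [← map_mul, ← map_add]
  rw [AdjoinRoot.mk_eq_mk]
  refine ⟨1, ?_⟩
  rw [Polynomial.map_sub, Polynomial.map_pow, map_X, map_C, hα, elt]
  simp only [map_mul, map_add]
  ring

theorem mk_C_algebraMap_mul_inv {a : F} (ha : a ≠ 0) :
    AdjoinRoot.mk (X ^ n - C α : (BaseRing F)[X]) (C (algebraMap F (BaseRing F) a))
      * AdjoinRoot.mk (X ^ n - C α : (BaseRing F)[X]) (C (algebraMap F (BaseRing F) a⁻¹)) = 1 := by
  rw [← map_mul, ← C_mul, ← map_mul, mul_inv_cancel₀ ha, map_one, C_1, map_one]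

/-- The ambient ring is local with maximal ideal `⟨x² - a, u, v⟩` when `x² - a` is irreducible. -/
theorem isUnit_or_exists_eq {a : F} (hirr : Irreducible (X ^ 2 - C a : F[X]))
    (hnil : IsNilpotent (yA n α a)) (w : Ambient n α) :
    IsUnit w ∨ ∃ b c d, w = yA n α a * b + uA n α * c + vA n α * d := by
  obtain ⟨P, rfl⟩ := AdjoinRoot.mk_surjective w
  obtain ⟨f, c, d, rfl⟩ := exists_map_add_eq P
  -- A Bézout relation makes f invertible modulo the nilpotent y, and adding multiples of u and v
  -- preserves units.
  rcases hirr.isCoprime_or_dvd f with h | ⟨q, rfl⟩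
  · left
    obtain ⟨b, e, hbe⟩ := h
    have h1 := congrArg (fun g => AdjoinRoot.mk (X ^ n - C α : (BaseRing F)[X])
      (g.map (algebraMap F (BaseRing F)))) hbe
    simp only [Polynomial.map_add, Polynomial.map_mul, map_add, map_mul, Polynomial.map_one,
      map_one, ← yA_eq_mk_map] at h1
    have hunit : IsUnit (AdjoinRoot.mk (X ^ n - C α : (BaseRing F)[X])
        (f.map (algebraMap F (BaseRing F)))) := by
      refine isUnit_of_mul_isUnit_right (x := AdjoinRoot.mk (X ^ n - C α : (BaseRing F)[X])
        (e.map (algebraMap F (BaseRing F)))) ?_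
      rw [← eq_sub_iff_add_eq'] at h1
      rw [h1]
      exact ((Commute.all _ _).isNilpotent_mul_left hnil).isUnit_one_sub
    have hnu : IsNilpotent (uA n α) := ⟨2, uA_sq⟩
    have hnv : IsNilpotent (vA n α) := ⟨2, vA_sq⟩
    rw [map_add, map_add, map_mul, map_mul]
    exact ((Commute.all _ _).isNilpotent_mul_right hnv).isUnit_add_left_of_commute
      (((Commute.all _ _).isNilpotent_mul_right hnu).isUnit_add_left_of_commute hunit
        (Commute.all _ _)) (Commute.all _ _)
  · right
    refine ⟨AdjoinRoot.mk _ (q.map (algebraMap F (BaseRing F))), AdjoinRoot.mk _ c,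
      AdjoinRoot.mk _ d, ?_⟩
    rw [yA_eq_mk_map, uA, vA]
    simp only [← map_mul, ← map_add, Polynomial.map_mul]

theorem irreducible_X_sq_sub_C {p : ℕ} [NeZero (2 : F)] {s : ℕ} {a a₁ a₂ a₃ a₄ : F} (ha₁ : a₁ ≠ 0)
    (ha : a ^ p ^ s = a₁) (hsq : ¬ IsSquare (elt a₁ a₂ a₃ a₄)) :
    Irreducible (X ^ 2 - C a : F[X]) := by
  rw [X_pow_sub_C_irreducible_iff_of_prime Nat.prime_two]
  rintro b rfl
  have hb : a₁ = b ^ p ^ s * b ^ p ^ s := by rw [← ha]; ring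
  refine hsq (isSquare_elt (b := b ^ p ^ s) ?_ hb _ _ _)
  rintro h
  rw [h, mul_zero] at hb
  exact ha₁ hb

open Classical in
theorem hammingNorm_smul_le {A : Type*} [CommRing A] {n : ℕ} (r : A) (c : Fin n → A) :
    hammingNorm (r • c) ≤ hammingNorm c := by
  refine Finset.card_le_card fun i hi => ?_
  rw [Finset.mem_filter] at hi ⊢
  refine ⟨hi.1, fun h => hi.2 ?_⟩
  rw [Pi.smul_apply, h, smul_zero]

/-- Multiplying by `u`, or dividing by it when that gives zero, turns a word of `codeD` into a word
of `codeB`. -/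
theorem dH_codeD_eq {p s : ℕ} [Fact p.Prime] [CharP F p] {α : BaseRing F} {a a₁ a₂ a₃ a₄ : F}
    (ha : a ^ p ^ s = a₁) (hα : α = elt a₁ a₂ a₃ a₄) (ha₃ : a₃ ≠ 0)
    (hirr : Irreducible (X ^ 2 - C a : F[X])) {ℓ t μ : ℕ} {z : Ambient (2 * p ^ s) α}
    (hμ : μ ≤ torsionIndex a ℓ t z) :
    dH (codeD a ℓ t μ z) = dH (codeB (2 * p ^ s) α a μ) := by
  classical
  have hp : p.Prime := Fact.out
  have hN : 0 < p ^ s := pow_pos hp.pos s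
  have hy := yA_pow ha hα
  have hd := mk_C_algebraMap_mul_inv (n := 2 * p ^ s) (α := α) ha₃
  have hnil : IsNilpotent (yA (2 * p ^ s) α a) := ⟨_, pow_eq_zero_of_eq uA_sq vA_sq hy⟩
  have hμj : ∀ j, uA (2 * p ^ s) α * yA (2 * p ^ s) α a ^ j ∈ codeC a ℓ t z → μ ≤ j :=
    fun j hj => hμ.trans (Nat.sInf_le hj)
  -- As u² = 0, u times the generator is u y^ℓ, so ℓ itself is an admissible index.
  have hμℓ : μ ≤ ℓ := by
    refine hμj ℓ (Ideal.mem_span_singleton.2 ⟨uA (2 * p ^ s) α, ?_⟩)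
    linear_combination (-(yA (2 * p ^ s) α a ^ t * z)) * uA_sq (n := 2 * p ^ s) (α := α)
  refine dH_eq_of_le (Ideal.span_mono (by simp)) fun c hc hc0 => ?_
  rw [mem_codeOfIdeal] at hc
  -- The annihilator of u in the base ring is ⟨u⟩, so a word killed by u is u times a word.
  by_cases huc : uElt F • c = 0
  · refine ⟨c, ?_, hc0, le_rfl⟩
    have hci : ∀ i, ∃ r, c i = uElt F * r := fun i =>
      exists_eq_u_mul_of_u_mul_eq_zero (congrFun huc i)
    choose c' hc' using hci
    have hcc' : c = uElt F • c' := funext hc'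
    have hw : AdjoinRoot.mk (X ^ (2 * p ^ s) - C α : (BaseRing F)[X]) (wordPoly c)
        = uA (2 * p ^ s) α * AdjoinRoot.mk _ (wordPoly c') := by
      rw [hcc', wordPoly_smul, map_mul, uA]
    rw [mem_codeOfIdeal, hw]
    rw [hw] at hc
    exact u_mul_mem_span_of_mem_span_pair hN uA_sq vA_sq hy hd
      (isUnit_or_exists_eq hirr hnil) hμj hc
  · refine ⟨uElt F • c, ?_, huc, hammingNorm_smul_le _ _⟩
    rw [mem_codeOfIdeal, wordPoly_smul, map_mul]
    obtain ⟨f, h, hfh⟩ := Ideal.mem_span_pair.1 hc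
    obtain ⟨i, rfl⟩ := Nat.exists_eq_add_of_le hμℓ
    refine Ideal.mem_span_singleton.2 ⟨f * yA (2 * p ^ s) α a ^ i, ?_⟩
    rw [← hfh, ← uA]
    linear_combination (f * yA (2 * p ^ s) α a ^ t * z + h * yA (2 * p ^ s) α a ^ μ)
      * uA_sq (n := 2 * p ^ s) (α := α)

theorem uA_mul_yA_pow {p s : ℕ} [Fact p.Prime] [CharP F p] {α : BaseRing F} {a a₁ a₂ a₃ a₄ : F}
    (ha : a ^ p ^ s = a₁) (hα : α = elt a₁ a₂ a₃ a₄) (k : ℕ) :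
    uA (2 * p ^ s) α * yA (2 * p ^ s) α a ^ (p ^ s + k)
      = AdjoinRoot.mk _ (C (algebraMap F (BaseRing F) a₃))
        * (uA (2 * p ^ s) α * vA (2 * p ^ s) α * yA (2 * p ^ s) α a ^ k) := by
  rw [pow_add, yA_pow ha hα]
  linear_combination ((AdjoinRoot.mk _ (C (algebraMap F (BaseRing F) a₂))
    + AdjoinRoot.mk _ (C (algebraMap F (BaseRing F) a₄)) * vA (2 * p ^ s) α)
      * yA (2 * p ^ s) α a ^ k) * uA_sq (n := 2 * p ^ s) (α := α)

theorem codeB_eq_span {p s : ℕ} [Fact p.Prime] [CharP F p] {α : BaseRing F} {a a₁ a₂ a₃ a₄ : F}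
    (ha : a ^ p ^ s = a₁) (hα : α = elt a₁ a₂ a₃ a₄) (ha₃ : a₃ ≠ 0) (k : ℕ) :
    codeB (2 * p ^ s) α a (p ^ s + k)
      = Ideal.span {uA (2 * p ^ s) α * vA (2 * p ^ s) α * yA (2 * p ^ s) α a ^ k} := by
  rw [codeB, uA_mul_yA_pow ha hα]
  exact Ideal.span_singleton_mul_left_unit
    (IsUnit.of_mul_eq_one _ (mk_C_algebraMap_mul_inv ha₃)) _

/-- The word with the coefficients of `uv q`, for a polynomial `q` over `F`. -/
noncomputable def uvWord (n : ℕ) (q : F[X]) : Fin n → BaseRing F :=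
  fun i => uElt F * vElt F * algebraMap F (BaseRing F) (q.coeff i)

theorem wordPoly_uvWord {q : F[X]} (hq : q.degree < n) :
    wordPoly (uvWord n q) = C (uElt F * vElt F) * q.map (algebraMap F (BaseRing F)) := by
  ext k
  rw [coeff_wordPoly, coeff_C_mul, coeff_map]
  split_ifs with h
  · rfl
  · rw [(degree_lt_iff_coeff_zero _ _).1 hq k (by omega), map_zero, mul_zero]

open Classical in
theorem hammingNorm_uvWord {q : F[X]} (hq : q.degree < n) :
    hammingNorm (uvWord n q) = q.support.card := by
  rw [hammingNorm, ← Finset.card_map Fin.valEmbedding]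
  congr 1
  ext k
  simp only [Finset.mem_map, Finset.mem_filter, Finset.mem_univ, true_and, Fin.valEmbedding_apply,
    uvWord, ne_eq, uv_mul_algebraMap_eq_zero_iff, mem_support_iff]
  constructor
  · rintro ⟨i, hi, rfl⟩
    exact hi
  · intro hk
    refine ⟨⟨k, ?_⟩, hk, rfl⟩
    by_contra h
    exact hk ((degree_lt_iff_coeff_zero _ _).1 hq k (by omega))

theorem uvWord_ne_zero {q : F[X]} (hq : q.degree < n) (hq0 : q ≠ 0) : uvWord n q ≠ 0 := by
  classical
  rw [← hammingNorm_ne_zero_iff, hammingNorm_uvWord hq]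
  exact (Finset.card_pos.2 (support_nonempty.2 hq0)).ne'

theorem uvWord_mem {a : F} {k : ℕ} {q : F[X]} (hq : q.degree < n)
    (hdvd : (X ^ 2 - C a) ^ k ∣ q) :
    uvWord n q ∈ codeOfIdeal (Ideal.span {uA n α * vA n α * yA n α a ^ k}) := by
  obtain ⟨h, rfl⟩ := hdvd
  rw [mem_codeOfIdeal, wordPoly_uvWord hq, Ideal.mem_span_singleton]
  refine ⟨AdjoinRoot.mk _ (h.map (algebraMap F (BaseRing F))), ?_⟩
  rw [uA, vA, yA_eq_mk_map]
  rw [Polynomial.map_mul, C_mul, Polynomial.map_pow]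
  simp only [map_mul, map_pow, mul_assoc]

theorem uElt_mul_vElt_mul_elt (a b c d : F) : uElt F * vElt F * elt a b c d
    = uElt F * vElt F * algebraMap F (BaseRing F) a := by
  rw [elt]
  linear_combination (vElt F * algebraMap F (BaseRing F) b
      + algebraMap F (BaseRing F) d * vElt F ^ 2) * uElt_sq (F := F)
    + (uElt F * algebraMap F (BaseRing F) c) * vElt_sq (F := F)

/-- The factor uv kills u and v, so only the F-part f of the cofactor matters, and uvα = uvα₁ turns
reduction modulo x^n - α into reduction modulo x^n - α₁ over F. That modulus is (X² - a)^N, so the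
remainder keeps the divisor (X² - a)^k. -/
theorem exists_eq_uvWord {a a₁ a₂ a₃ a₄ : F} {k N : ℕ} (hn : n ≠ 0) (hkN : k ≤ N)
    (hpow : (X ^ 2 - C a : F[X]) ^ N = X ^ n - C a₁) (hα : α = elt a₁ a₂ a₃ a₄)
    {c : Fin n → BaseRing F}
    (hc : c ∈ codeOfIdeal (Ideal.span {uA n α * vA n α * yA n α a ^ k})) :
    ∃ q : F[X], q.degree < n ∧ (X ^ 2 - C a) ^ k ∣ q ∧ c = uvWord n q := by
  have : Nontrivial (BaseRing F) := by
    refine ⟨uElt F * vElt F * algebraMap F (BaseRing F) 1, 0, ?_⟩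
    rw [ne_eq, uv_mul_algebraMap_eq_zero_iff]
    exact one_ne_zero
  rw [mem_codeOfIdeal, Ideal.mem_span_singleton] at hc
  obtain ⟨w, hw⟩ := hc
  obtain ⟨P, rfl⟩ := AdjoinRoot.mk_surjective w
  obtain ⟨f, b, d, rfl⟩ := exists_map_add_eq P
  have hmon := monic_X_pow_sub_C a₁ hn
  set g := (X ^ 2 - C a) ^ k * f with hg
  set q := g %ₘ (X ^ n - C a₁) with hq
  have hqdeg : q.degree < n := by
    rw [← degree_X_pow_sub_C (Nat.pos_of_ne_zero hn) a₁]
    exact degree_modByMonic_lt _ hmon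
  have hqg : q + (X ^ n - C a₁) * (g /ₘ (X ^ n - C a₁)) = g := modByMonic_add_div _ _
  refine ⟨q, hqdeg, ?_, ?_⟩
  · have h1 : q = g - (X ^ n - C a₁) * (g /ₘ (X ^ n - C a₁)) := eq_sub_of_add_eq hqg
    rw [h1]
    refine dvd_sub (Dvd.intro _ rfl) (Dvd.dvd.mul_right ?_ _)
    rw [← hpow]
    exact pow_dvd_pow _ hkN
  · have hwp : wordPoly c = wordPoly (uvWord n q) := by
      refine eq_of_mk_eq_of_degree_lt (α := α) hn (degree_wordPoly_lt _) (degree_wordPoly_lt _) ?_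
      have hαuv : C (uElt F * vElt F) * (X ^ n - C a₁ : F[X]).map (algebraMap F (BaseRing F))
          = C (uElt F * vElt F) * (X ^ n - C α : (BaseRing F)[X]) := by
        rw [Polynomial.map_sub, Polynomial.map_pow, map_X, map_C, mul_sub, mul_sub, ← C_mul,
          ← C_mul, hα, uElt_mul_vElt_mul_elt]
      have hgmap := congrArg (fun e => C (uElt F * vElt F) * e.map (algebraMap F (BaseRing F))) hqg
      simp only [Polynomial.map_add, Polynomial.map_mul, mul_add, ← mul_assoc, hαuv] at hgmap
      have hu : (C (uElt F) : (BaseRing F)[X]) ^ 2 = 0 := by rw [← C_pow, uElt_sq, C_0]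
      have hv : (C (vElt F) : (BaseRing F)[X]) ^ 2 = 0 := by rw [← C_pow, vElt_sq, C_0]
      rw [hw, uA, vA, yA_eq_mk_map, wordPoly_uvWord hqdeg]
      simp only [← map_mul, ← map_pow, ← Polynomial.map_pow]
      rw [AdjoinRoot.mk_eq_mk]
      refine ⟨C (uElt F * vElt F) * (g /ₘ (X ^ n - C a₁)).map (algebraMap F (BaseRing F)), ?_⟩
      rw [hg, Polynomial.map_mul] at hgmap
      rw [hg]
      simp only [C_mul] at hgmap ⊢
      set Y := ((X ^ 2 - C a : F[X]) ^ k).map (algebraMap F (BaseRing F))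
      linear_combination -hgmap + (C (vElt F) * Y * b) * hu + (C (uElt F) * Y * d) * hv
    funext i
    have := congrArg (fun e => e.coeff i) hwp
    simpa [coeff_wordPoly] using this

end AmbientFacts

/-! ### Distances of the codes ⟨u y^μ⟩ -/

section Distances

variable {F : Type*} [Field F] {p s : ℕ} [Fact p.Prime] [CharP F p] {α : BaseRing F}
  {a a₁ a₂ a₃ a₄ : F}

theorem dH_codeB_eq_one (ha : a ^ p ^ s = a₁) (hα : α = elt a₁ a₂ a₃ a₄) (ha₃ : a₃ ≠ 0) {μ : ℕ}
    (hμ : μ ≤ p ^ s) : dH (codeB (2 * p ^ s) α a μ) = 1 := by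
  classical
  have hp : p.Prime := Fact.out
  have hdeg : (1 : F[X]).degree < (2 * p ^ s : ℕ) := by
    rw [degree_one]
    exact_mod_cast Nat.mul_pos two_pos (pow_pos hp.pos s)
  have hle : codeB (2 * p ^ s) α a (p ^ s + 0) ≤ codeB (2 * p ^ s) α a μ :=
    Ideal.span_singleton_le_span_singleton.2 (mul_dvd_mul_left _ (pow_dvd_pow _ hμ))
  refine dH_eq_of_bounds ⟨uvWord _ 1, hle ?_, uvWord_ne_zero hdeg one_ne_zero, ?_⟩
    fun c _ hc0 => Nat.one_le_iff_ne_zero.2 (hammingNorm_ne_zero_iff.2 hc0)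
  · rw [codeB_eq_span ha hα ha₃]
    exact uvWord_mem hdeg (by simp)
  · rw [hammingNorm_uvWord hdeg]
    refine (card_support_le_of_natDegree_lt (n := 1) ?_)
    rw [natDegree_one]
    exact one_pos

theorem dH_codeB_eq {γ e Γ k : ℕ} (ha : a ^ p ^ (e + (γ + 1)) = a₁)
    (hα : α = elt a₁ a₂ a₃ a₄) (ha₁ : a₁ ≠ 0) (ha₃ : a₃ ≠ 0) (hΓ : 1 ≤ Γ) (hΓp : Γ ≤ p - 1)
    (hk : p ^ e * (p * (p ^ γ - 1) + (Γ - 1)) + 1 ≤ k)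
    (hk' : k ≤ p ^ e * (p * (p ^ γ - 1) + Γ)) :
    dH (codeB (2 * p ^ (e + (γ + 1))) α a (p ^ (e + (γ + 1)) + k)) = (Γ + 1) * p ^ γ := by
  classical
  have hp : p.Prime := Fact.out
  have hN : 0 < p ^ (e + (γ + 1)) := pow_pos hp.pos _
  have ha0 : a ≠ 0 := by
    rintro rfl
    rw [zero_pow hN.ne'] at ha
    exact ha₁ ha.symm
  -- Because Γ < p, the power of X² - a at the top of the range has degree below the length, so it
  -- is a word without reduction.
  have hlt : p ^ e * (p * (p ^ γ - 1) + Γ) < p ^ (e + (γ + 1)) := by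
    rw [pow_add, pow_succ' p γ]
    refine Nat.mul_lt_mul_of_pos_left ?_ (pow_pos hp.pos _)
    have h1 : p ≤ p * p ^ γ := Nat.le_mul_of_pos_right _ (pow_pos hp.pos _)
    have h2 := hp.two_le
    rw [Nat.mul_sub, mul_one]
    omega
  rw [codeB_eq_span ha hα ha₃]
  refine dH_eq_of_bounds ?_ fun c hc hc0 => ?_
  · have hmon : ((X ^ 2 - C a : F[X]) ^ (p ^ e * (p * (p ^ γ - 1) + Γ))).Monic :=
      (monic_X_pow_sub_C a two_ne_zero).pow _
    have hdeg : ((X ^ 2 - C a : F[X]) ^ (p ^ e * (p * (p ^ γ - 1) + Γ))).degree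
        < (2 * p ^ (e + (γ + 1)) : ℕ) := by
      rw [degree_eq_natDegree hmon.ne_zero, natDegree_pow, natDegree_X_pow_sub_C]
      exact_mod_cast (by omega)
    refine ⟨uvWord _ _, uvWord_mem hdeg (pow_dvd_pow _ hk'), uvWord_ne_zero hdeg hmon.ne_zero, ?_⟩
    rw [hammingNorm_uvWord hdeg]
    exact card_support_X_sq_sub_C_pow_le a γ e Γ
  · obtain ⟨q, hqdeg, hdvd, rfl⟩ := exists_eq_uvWord (by omega) (hk'.trans hlt.le)
      (X_sq_sub_C_pow _ ha) hα hc
    have hq0 : q ≠ 0 := by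
      rintro rfl
      exact hc0 (by funext i; simp [uvWord])
    rw [hammingNorm_uvWord hqdeg]
    exact le_card_support_of_X_sq_sub_C_pow_dvd ha0 hΓ hq0
      ((natDegree_lt_iff_degree_lt hq0).2 hqdeg) ((pow_dvd_pow _ hk).trans hdvd)

end Distances

end ConstacyclicUV

theorem theorem6 {F : Type*} [Field F] [Finite F] (p m s : ℕ) (hp : p.Prime) (hp2 : p ≠ 2)
    (hm : 0 < m) (hs : 0 < s) (hF : Nat.card F = p ^ m)
    (α₁ α₂ α₃ α₄ : F) (hα₁ : α₁ ≠ 0) (hα₂ : α₂ ≠ 0) (hα₃ : α₃ ≠ 0)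
    (α : ConstacyclicUV.BaseRing F) (hα : α = ConstacyclicUV.elt α₁ α₂ α₃ α₄)
    (hsq : ¬ IsSquare α)
    (α₀ : F) (hα₀ : α₀ = ConstacyclicUV.alphaZero p m s α₁)
    (ℓ t μ : ℕ) (hℓ : ℓ ≤ 2 * p ^ s - 1) (ht : t < ℓ)
    (z : ConstacyclicUV.Ambient (2 * p ^ s) α) (hz : z = 0 ∨ IsUnit z)
    (hμ : μ ≤ ConstacyclicUV.torsionIndex α₀ ℓ t z) :
    ConstacyclicUV.dH (ConstacyclicUV.codeD α₀ ℓ t μ z)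
        = ConstacyclicUV.dH (ConstacyclicUV.codeB (2 * p ^ s) α α₀ μ) ∧
    (μ ≤ p ^ s → ConstacyclicUV.dH (ConstacyclicUV.codeD α₀ ℓ t μ z) = 1) ∧
    (∀ Γ γ : ℕ, 1 ≤ Γ → Γ ≤ p - 1 → γ ≤ s - 1 →
      2 * p ^ s - p ^ (s - γ) + (Γ - 1) * p ^ (s - γ - 1) + 1 ≤ μ →
      μ ≤ 2 * p ^ s - p ^ (s - γ) + Γ * p ^ (s - γ - 1) →
      ConstacyclicUV.dH (ConstacyclicUV.codeD α₀ ℓ t μ z) = (Γ + 1) * p ^ γ) := by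
  have : Fact p.Prime := ⟨hp⟩
  have hchar : CharP F p := by
    have := Fintype.ofFinite F
    rw [Nat.card_eq_fintype_card] at hF
    exact charP_of_card_eq_prime_pow hF
  have h2 : NeZero (2 : F) := ⟨Ring.two_ne_zero (by rwa [ringChar.eq F p])⟩
  have hroot : α₀ ^ p ^ s = α₁ := by
    rw [hα₀]
    exact ConstacyclicUV.alphaZero_pow p m s hm hF α₁
  have hirr : Irreducible (X ^ 2 - C α₀ : F[X]) :=
    ConstacyclicUV.irreducible_X_sq_sub_C hα₁ hroot (hα ▸ hsq)
  have heq := ConstacyclicUV.dH_codeD_eq hroot hα hα₃ hirr hμ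
  refine ⟨heq, fun hμs => ?_, fun Γ γ hΓ hΓp hγ h₁ h₂ => ?_⟩
  · rw [heq]
    exact ConstacyclicUV.dH_codeB_eq_one hroot hα hα₃ hμs
  · rw [heq]
    clear heq hμ hα₀
    obtain ⟨e, rfl⟩ : ∃ e, s = e + (γ + 1) := ⟨s - (γ + 1), by omega⟩
    have e1 : e + (γ + 1) - γ = e + 1 := by omega
    rw [e1, Nat.add_sub_cancel] at h₁
    rw [e1, Nat.add_sub_cancel] at h₂
    -- With s = e + γ + 1, the bounds on k = μ - p^s read p^s - p^(e+1) + G·p^e, G being Γ - 1 or Γ.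
    -- Writing p^γ = g + 1 removes the truncated subtractions and leaves linear arithmetic.
    obtain ⟨g, hg⟩ : ∃ g, p ^ γ = g + 1 := Nat.exists_eq_succ_of_ne_zero (pow_pos hp.pos γ).ne'
    have e3 : p ^ (e + (γ + 1)) = p ^ e * p * g + p ^ (e + 1) := by
      rw [pow_add, pow_succ, pow_succ, hg]; ring
    have e4 : ∀ G, p ^ e * (p * (p ^ γ - 1) + G) = p ^ e * p * g + G * p ^ e := by
      intro G
      rw [hg, Nat.add_sub_cancel]; ring
    obtain ⟨k, rfl⟩ := Nat.exists_eq_add_of_le (show p ^ (e + (γ + 1)) ≤ μ by omega)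
    exact ConstacyclicUV.dH_codeB_eq hroot hα hα₁ hα₃ hΓ hΓp (by rw [e4]; omega)
      (by rw [e4]; omega)
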